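/- Let $k\ge 0$ be an integer. For integer partitions $\mu\subseteq\lambda$ (inclusion of Young diagrams) let $|\lambda/\mu|$ be the number of boxes of $\lambda$ not in $\mu$. A \emph{simplified vacillating tableau} of shape $\mu$ and length $2k$ is a sequence of integer partitions $(\mu^{(0)}=\emptyset,\mu^{(1/2)},\mu^{(1)},\dots,\mu^{(k-1/2)},\mu^{(k)}=\mu)$ such that for each $j=0,\dots,k-1$: (a) $\mu^{(j)}\supseteq\mu^{(j+1/2)}$ and $|\mu^{(j)}/\mu^{(j+1/2)}|\in\{0,1\}$; (b) $\mu^{(j+1/2)}\subseteq\mu^{(j+1)}$ and $|\mu^{(j+1)}/\mu^{(j+1/2)}|\in\{0,1\}$. It is a \emph{limiting vacillating tableau} if moreover $|\mu^{(j+1)}/\mu^{(j+1/2)}|=1$ for every $j=0,\dots,k-1$. Let $g_k(\mu)$ and $a_k(\mu)$ be the numbers of simplified, respectively limiting, vacillating tableaux of shape $\mu$ and length $2k$. Let $B(k,j)$ be the number of set partitions of $[k]=\{1,\dots,k\}$ with $j$ marked blocks (pairs of a set partition of $[k]$ and a set of $j$ of its blocks), and let $S(k,j)$ be the number of set partitions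 of $[k]$ with exactly $j$ blocks. In the ring of formal power series in $\boldsymbol{x}=(x_1,x_2,\dots)$ over an arbitrary commutative ring, let $h_1(\boldsymbol{x})=\sum_{i\ge1}x_i$ and let $s_\mu(\boldsymbol{x})=\sum_T\prod_{i\ge1}x_i^{\alpha_i(T)}$ be the Schur function, where $T$ ranges over all semistandard Young tableaux of shape $\mu$ with entries in the positive integers and $\alpha_i(T)$ is the number of entries of $T$ equal to $i$. Then $g_k(\mu)$ and $a_k(\mu)$ are nonzero for only finitely many integer partitions $\mu$, $S(k,j)$ is nonzero for only finitely many $j$, and \[ \sum_\mu g_k(\mu)\,s_\mu(\boldsymbol{x})=\sum_{j=0}^k B(k,j)\,h_1(\boldsymbol{x})^j, \qquad \sum_\mu a_k(\mu)\,s_\mu(\boldsymbol{x})=\sum_{j\ge0}S(k,j)\,h_1(\boldsymbol{x})^j, \] where both sums on the left range over all integer partitions $\mu$. -/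

import Mathlib

noncomputable section

namespace VacillatingTableaux

/-- `skewSize lam mu` is the number of boxes `|λ / μ|` of the skew shape `λ / μ` (for `μ ⊆ λ`).
Integer partitions are represented by their Young diagrams, ordered by inclusion. -/
def skewSize (lam mu : YoungDiagram) : ℕ :=
  (lam.cells \ mu.cells).card

/-- `t` is a simplified vacillating tableau of shape `mu` and length `2k`: the entry `t i` is the
partition `μ^(i/2)`, for `i = 0, …, 2k`. -/
def IsSimplifiedVT (k : ℕ) (mu : YoungDiagram) (t : Fin (2 * k + 1) → YoungDiagram) : Prop :=
  t 0 = ⊥ ∧ t (Fin.last (2 * k)) = mu ∧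
    ∀ (j : ℕ) (_ : j < k),
      (t ⟨2 * j + 1, by omega⟩ ≤ t ⟨2 * j, by omega⟩ ∧
        skewSize (t ⟨2 * j, by omega⟩) (t ⟨2 * j + 1, by omega⟩) ≤ 1) ∧
      (t ⟨2 * j + 1, by omega⟩ ≤ t ⟨2 * j + 2, by omega⟩ ∧
        skewSize (t ⟨2 * j + 2, by omega⟩) (t ⟨2 * j + 1, by omega⟩) ≤ 1)

/-- `t` is a limiting vacillating tableau of shape `mu` and length `2k`: as above, but exactly one
box is added in each adding step. -/
def IsLimitingVT (k : ℕ) (mu : YoungDiagram) (t : Fin (2 * k + 1) → YoungDiagram) : Prop :=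
  t 0 = ⊥ ∧ t (Fin.last (2 * k)) = mu ∧
    ∀ (j : ℕ) (_ : j < k),
      (t ⟨2 * j + 1, by omega⟩ ≤ t ⟨2 * j, by omega⟩ ∧
        skewSize (t ⟨2 * j, by omega⟩) (t ⟨2 * j + 1, by omega⟩) ≤ 1) ∧
      (t ⟨2 * j + 1, by omega⟩ ≤ t ⟨2 * j + 2, by omega⟩ ∧
        skewSize (t ⟨2 * j + 2, by omega⟩) (t ⟨2 * j + 1, by omega⟩) = 1)

/-- `g_k(μ)`: the number of simplified vacillating tableaux of shape `μ` and length `2k`. -/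
def g (k : ℕ) (mu : YoungDiagram) : ℕ :=
  {t : Fin (2 * k + 1) → YoungDiagram | IsSimplifiedVT k mu t}.ncard

/-- `a_k(μ)`: the number of limiting vacillating tableaux of shape `μ` and length `2k`. -/
def a (k : ℕ) (mu : YoungDiagram) : ℕ :=
  {t : Fin (2 * k + 1) → YoungDiagram | IsLimitingVT k mu t}.ncard

/-- `B(k, j)`: the number of set partitions of a `k`-element set with `j` marked blocks, that is,
of pairs of a set partition and a `j`-element set of its blocks. -/
def B (k j : ℕ) : ℕ :=
  {Q : Finpartition (Finset.univ : Finset (Fin k)) × Finset (Finset (Fin k)) |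
    Q.2 ⊆ Q.1.parts ∧ Q.2.card = j}.ncard

/-- The Stirling number of the second kind `S(k, j)`: the number of set partitions of a
`k`-element set with exactly `j` blocks. -/
def S (k j : ℕ) : ℕ :=
  {P : Finpartition (Finset.univ : Finset (Fin k)) | P.parts.card = j}.ncard

/-- `mult T i` is `α_i(T)`, the number of times that `i` appears in the tableau `T`. -/
def mult {mu : YoungDiagram} (T : SemistandardYoungTableau mu) (i : ℕ) : ℕ :=
  (mu.cells.filter fun c => T c.1 c.2 = i).card

/-- The Schur function `s_μ = ∑_T x^T` in the variables `x_1, x_2, …`, where `T` ranges over the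
semistandard Young tableaux of shape `μ` with positive entries: the coefficient of `x^d` is the
number of those `T` with `α_i(T) = d_i` for all `i ≥ 1`. -/
def schur (R : Type*) [CommRing R] (mu : YoungDiagram) : MvPowerSeries ℕ+ R :=
  fun d => (({T : SemistandardYoungTableau mu |
    (∀ c ∈ mu.cells, 0 < T c.1 c.2) ∧ ∀ i : ℕ+, mult T (i : ℕ) = d i}.ncard : ℕ) : R)

open Classical in
/-- The formal power series `h_1 = ∑_i x_i`: the coefficient of `x^d` is `1` if `x^d` is one of
the variables, and `0` otherwise. -/
def h1 (R : Type*) [CommRing R] : MvPowerSeries ℕ+ R :=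
  fun d => if ∃ i : ℕ+, d = Finsupp.single i 1 then 1 else 0

end VacillatingTableaux

end

/-!
Vacillating tableaux are walks in Young's lattice, so they are counted by operators on the free
module on all Young diagrams. Let `U` add a box in all possible ways, let `D` remove a box in all
possible ways, and let `e` be the empty diagram. Then `a k mu` is the coefficient of `mu` in
`(U (1 + D)) ^ k e`, and `g k mu` is its coefficient in `((1 + U) (1 + D)) ^ k e` (`a_eq`, `g_eq`).

The operators satisfy `D U = U D + 1` (`D_mul_U`), and so `D X = X D + 1` holds both for `X = U` and
for `X = 1 + U`. As `D e = 0`, this gives `X (1 + D) X ^ n e = X ^ (n + 1) e + n X ^ n e`. Inserting a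
new element into a set partition with `n` blocks yields one partition with `n + 1` blocks and `n`
partitions with `n` blocks, so by induction `(X (1 + D)) ^ k e` is the sum of `X ^ #P e` over all set
partitions `P` of a `k`-element set, where `#P` is the number of blocks
(`pow_apply_eq_sum_finpartition`).

The linear map sending a diagram to its Schur function turns `U` into multiplication by `h_1`, by the
Pieri rule (`sum_up_schur`). Hence the two generating functions are the sums of `h_1 ^ #P` and of
`(1 + h_1) ^ #P`; expanding the latter by the binomial theorem amounts to marking blocks (`sum_B`).

Both the Pieri rule and `D U = U D + 1` come from one fact about horizontal strips,
`sum_up_sum_strips`: adding a box and then removing a horizontal strip of `m` boxes is the same as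
doing this in the opposite order, plus removing a horizontal strip of `m - 1` boxes. Since the cells
of a semistandard tableau containing its largest entry form a horizontal strip, the Pieri rule
follows by induction on the number of variables (`kostka_succ`, `sum_up_kostka`).
-/

noncomputable section

open Finset

namespace VacillatingTableaux

/-! ### Adding boxes and horizontal strips -/

lemma finite_setOf_card_le (n : ℕ) : {mu : YoungDiagram | mu.card ≤ n}.Finite := by
  refine Set.Finite.of_finite_image (f := YoungDiagram.cells)
    ((range n ×ˢ range n).powerset.finite_toSet.subset ?_)
    (fun _ _ _ _ h => YoungDiagram.ext h)
  rintro _ ⟨mu, hmu, rfl⟩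
  have hmu : mu.card ≤ n := hmu
  simp only [coe_powerset, Set.mem_preimage, Set.mem_powerset_iff, coe_subset]
  rintro ⟨i, j⟩ h
  rw [YoungDiagram.mem_cells] at h
  have h1 := YoungDiagram.mem_iff_lt_rowLen.1 h
  have h2 := YoungDiagram.mem_iff_lt_colLen.1 h
  have h3 : mu.rowLen i ≤ mu.card := by
    rw [YoungDiagram.rowLen_eq_card]; exact card_le_card (filter_subset _ _)
  have h4 : mu.colLen j ≤ mu.card := by
    rw [YoungDiagram.colLen_eq_card]; exact card_le_card (filter_subset _ _)
  simp only [mem_product, mem_range]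
  omega

lemma le_iff_rowLen {mu lam : YoungDiagram} :
    mu ≤ lam ↔ ∀ i, mu.rowLen i ≤ lam.rowLen i := by
  constructor
  · intro h i
    by_contra! hlt
    have h1 : (i, lam.rowLen i) ∈ mu := YoungDiagram.mem_iff_lt_rowLen.2 hlt
    exact lt_irrefl _ (YoungDiagram.mem_iff_lt_rowLen.1 (h h1))
  · rintro h ⟨i, j⟩ hc
    exact YoungDiagram.mem_iff_lt_rowLen.2
      ((YoungDiagram.mem_iff_lt_rowLen.1 hc).trans_le (h i))

lemma rowLen_injective : Function.Injective YoungDiagram.rowLen := fun _ _ h =>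
  le_antisymm (le_iff_rowLen.2 fun i => (congrFun h i).le)
    (le_iff_rowLen.2 fun i => (congrFun h i).ge)

lemma exists_rowLen_eq_zero (mu : YoungDiagram) : ∃ n, mu.rowLen n = 0 := by
  refine ⟨mu.colLen 0, ?_⟩
  by_contra h
  have := YoungDiagram.mem_iff_lt_rowLen.2 (Nat.pos_of_ne_zero h)
  exact lt_irrefl _ (YoungDiagram.mem_iff_lt_colLen.1 this)

lemma exists_rowLen_eq {f : ℕ → ℕ} (hf : Antitone f) (h0 : ∃ n, f n = 0) :
    ∃ mu : YoungDiagram, mu.rowLen = f := by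
  obtain ⟨n, hn⟩ := h0
  let mu : YoungDiagram :=
    { cells := (range n ×ˢ range (f 0)).filter fun c => c.2 < f c.1
      isLowerSet := by
        rintro ⟨i, j⟩ ⟨i', j'⟩ hle h
        obtain ⟨h1, h2⟩ := Prod.mk_le_mk.1 hle
        have := hf h1
        simp only [coe_filter, mem_product, mem_range, Set.mem_ofPred_eq] at h ⊢
        omega }
  have hmem : ∀ i j, (i, j) ∈ mu ↔ j < f i := by
    intro i j
    rw [← YoungDiagram.mem_cells]
    simp only [mu, mem_filter, mem_product, mem_range, and_iff_right_iff_imp]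
    intro h
    refine ⟨?_, h.trans_le (hf (Nat.zero_le i))⟩
    by_contra! hni
    have := hf hni
    omega
  refine ⟨mu, funext fun i => ?_⟩
  refine le_antisymm ?_ ?_
  · by_contra! h
    exact lt_irrefl _ ((hmem _ _).1 (YoungDiagram.mem_iff_lt_rowLen.2 h))
  · by_contra! h
    exact lt_irrefl _ (YoungDiagram.mem_iff_lt_rowLen.1 ((hmem _ _).2 h))

/-- The diagrams obtained from `mu` by adding one box. -/
def up (mu : YoungDiagram) : Finset YoungDiagram := by
  classical
  exact (finite_setOf_card_le (mu.card + 1)).toFinset.filter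
    fun lam => mu ≤ lam ∧ lam.card = mu.card + 1

lemma mem_up {mu lam : YoungDiagram} : lam ∈ up mu ↔ mu ≤ lam ∧ lam.card = mu.card + 1 := by
  classical
  simp only [up, mem_filter, Set.Finite.mem_toFinset, Set.mem_ofPred_eq]
  exact ⟨fun h => h.2, fun h => ⟨h.2.le, h⟩⟩

/-- `f / g` is a horizontal strip, for sequences `f`, `g` of row lengths: the rows interlace as
`f 0 ≥ g 0 ≥ f 1 ≥ g 1 ≥ ⋯`. -/
def Interlace (f g : ℕ → ℕ) : Prop := ∀ i, f (i + 1) ≤ g i ∧ g i ≤ f i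

/-- The diagrams `mu` such that `lam / mu` is a horizontal strip with `m` boxes. -/
def strips (lam : YoungDiagram) (m : ℕ) : Finset YoungDiagram := by
  classical
  exact (finite_setOf_card_le lam.card).toFinset.filter
    fun mu => Interlace lam.rowLen mu.rowLen ∧ lam.card = mu.card + m

lemma mem_strips {lam mu : YoungDiagram} {m : ℕ} :
    mu ∈ strips lam m ↔ Interlace lam.rowLen mu.rowLen ∧ lam.card = mu.card + m := by
  classical
  simp only [strips, mem_filter, Set.Finite.mem_toFinset, Set.mem_ofPred_eq]
  exact ⟨fun h => h.2, fun h => ⟨by omega, h⟩⟩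

lemma Interlace.le {lam mu : YoungDiagram} (h : Interlace lam.rowLen mu.rowLen) : mu ≤ lam :=
  le_iff_rowLen.2 fun i => (h i).2

lemma interlace_iff {lam mu : YoungDiagram} : Interlace lam.rowLen mu.rowLen ↔
    mu ≤ lam ∧ ∀ i j, (i + 1, j) ∈ lam → (i, j) ∈ mu := by
  constructor
  · refine fun h => ⟨h.le, fun i j hij => ?_⟩
    rw [YoungDiagram.mem_iff_lt_rowLen] at hij ⊢
    exact hij.trans_le (h i).1
  · rintro ⟨h1, h2⟩ i
    refine ⟨?_, le_iff_rowLen.1 h1 i⟩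
    by_contra! hlt
    exact lt_irrefl _ (YoungDiagram.mem_iff_lt_rowLen.1
      (h2 _ _ (YoungDiagram.mem_iff_lt_rowLen.2 hlt)))

lemma mem_up_iff_rowLen {mu lam : YoungDiagram} :
    lam ∈ up mu ↔ ∃ i, lam.rowLen = fun k => mu.rowLen k + if k = i then 1 else 0 := by
  rw [mem_up]
  constructor
  · rintro ⟨hle, hcard⟩
    have hcard : lam.cells.card = mu.cells.card + 1 := hcard
    obtain ⟨⟨i, j⟩, hc, hins⟩ : ∃ c, c ∉ mu.cells ∧ insert c mu.cells = lam.cells := by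
      have h1 : (lam.cells \ mu.cells).card = 1 := by
        rw [card_sdiff_of_subset (YoungDiagram.cells_subset_iff.2 hle)]; omega
      obtain ⟨c, hc⟩ := card_eq_one.1 h1
      refine ⟨c, (mem_sdiff.1 (hc ▸ mem_singleton_self c)).2, ?_⟩
      rw [insert_eq, ← hc, sdiff_union_of_subset (YoungDiagram.cells_subset_iff.2 hle)]
    refine ⟨i, funext fun k => ?_⟩
    rw [YoungDiagram.rowLen_eq_card, YoungDiagram.rowLen_eq_card, YoungDiagram.row, ← hins,
      filter_insert]
    by_cases h : k = i
    · subst h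
      rw [if_pos rfl, if_pos rfl, card_insert_of_notMem fun h' => hc (mem_filter.1 h').1]
      rfl
    · rw [if_neg h, if_neg (Ne.symm h)]
      rfl
  · rintro ⟨i, h⟩
    have h' := fun k => congrFun h k
    refine ⟨le_iff_rowLen.2 fun k => by rw [h' k]; omega, ?_⟩
    have : lam.cells = insert (i, mu.rowLen i) mu.cells := by
      ext ⟨k, j⟩
      rw [mem_insert, YoungDiagram.mem_cells, YoungDiagram.mem_cells,
        YoungDiagram.mem_iff_lt_rowLen, YoungDiagram.mem_iff_lt_rowLen, h' k, Prod.mk.injEq]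
      split_ifs with hk
      · subst hk; omega
      · simp [hk]
    rw [YoungDiagram.card, this, card_insert_of_notMem]
    rw [YoungDiagram.mem_cells, YoungDiagram.mem_iff_lt_rowLen]
    exact lt_irrefl _

lemma mem_strips_one {lam mu : YoungDiagram} : mu ∈ strips lam 1 ↔ lam ∈ up mu := by
  rw [mem_strips]
  refine ⟨fun h => mem_up.2 ⟨h.1.le, h.2⟩, fun h => ⟨?_, (mem_up.1 h).2⟩⟩
  obtain ⟨i, hi⟩ := mem_up_iff_rowLen.1 h
  intro k
  have h1 := congrFun hi k
  have h2 := congrFun hi (k + 1)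
  have h3 := mu.rowLen_anti k (k + 1) (Nat.le_succ k)
  have h4 := lam.rowLen_anti k (k + 1) (Nat.le_succ k)
  split_ifs at h1 h2 <;> omega

lemma Interlace.antitone {f g : ℕ → ℕ} (h : Interlace f g) : Antitone f ∧ Antitone g :=
  ⟨antitone_nat_of_succ_le fun i => (h i).1.trans (h i).2,
    antitone_nat_of_succ_le fun i => (h (i + 1)).2.trans (h i).1⟩

open Classical in
/-- The counting of `card_filter_up` in terms of the row to which a box is added. If `l / n` is a
horizontal strip, a box can be added to row `i + 1` of `l` exactly if one can be removed from row
`i` of `n`, and a box can always be added to row `0`; otherwise the only possible row is the one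
violating `n i ≤ l i`, and it is the same row in both cases. -/
lemma ncard_interlace_add {l n : ℕ → ℕ} (hl : Antitone l) (hn : Antitone n)
    (h0 : ∃ N, n N = 0) :
    {i | Interlace (fun k => l k + if k = i then 1 else 0) n}.ncard =
      {i | 0 < n i ∧ Interlace l (fun k => n k - if k = i then 1 else 0)}.ncard +
        if Interlace l n then 1 else 0 := by
  obtain ⟨N, hN⟩ := h0
  have hfin : {i | 0 < n i ∧ Interlace l (fun k => n k - if k = i then 1 else 0)}.Finite := by
    refine (Set.finite_lt_nat N).subset fun i hi => ?_
    by_contra! h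
    have := hn (not_lt.1 h)
    have := hi.1
    omega
  split_ifs with h
  · have : {i | Interlace (fun k => l k + if k = i then 1 else 0) n} = insert 0 (Nat.succ ''
        {i | 0 < n i ∧ Interlace l (fun k => n k - if k = i then 1 else 0)}) := by
      ext i
      rcases i with _ | i
      · simp only [Set.mem_ofPred_eq, Set.mem_insert_iff, true_or, iff_true]
        intro k
        have h1 := (h k).1
        have h2 := (h k).2
        simp only [Nat.add_eq_zero_iff, one_ne_zero, and_false, if_false, add_zero]
        exact ⟨h1, h2.trans (Nat.le_add_right _ _)⟩
      · simp only [Set.mem_ofPred_eq, Set.mem_insert_iff, Nat.add_eq_zero_iff, one_ne_zero,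
          and_false, false_or, Set.mem_image, Nat.succ_eq_add_one, Nat.add_right_cancel_iff,
          exists_eq_right]
        constructor
        · intro h'
          have := (h' i).1
          simp only [if_true] at this
          refine ⟨by omega, fun k => ?_⟩
          have := h k
          simp only
          split_ifs with hk
          · subst hk; omega
          · omega
        · rintro ⟨h1, h2⟩ k
          have := h2 i
          have := h k
          have := h i
          simp only [if_true] at *
          split_ifs with h3 h4 h4
          · omega
          · obtain rfl : k = i := by omega
            omega
          · omega
          · omega
    rw [this, Set.ncard_insert_of_notMem (by simp) (hfin.image _),
      Set.ncard_image_of_injective _ Nat.succ_injective]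
  · rw [add_zero]
    congr 1
    ext i
    simp only [Set.mem_ofPred_eq]
    constructor
    · intro h'
      -- Row `i` has to be the one violating `n i ≤ l i`, or `l / n` would be a strip.
      have hi : n i = l i + 1 := by
        by_contra hne
        refine h fun k => ?_
        have h1 := h' k
        have h2 := (h' i).2
        simp only [if_true] at h1 h2
        by_cases hk : k = i
        · subst hk
          simp only [if_true, Nat.succ_ne_self, if_false] at h1
          omega
        · rw [if_neg hk] at h1
          exact ⟨(Nat.le_add_right _ _).trans h1.1, h1.2⟩
      refine ⟨by omega, fun k => ?_⟩
      have h1 := h' k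
      have h2 := hl (Nat.le_succ i)
      by_cases hk : k = i
      · subst hk
        simp only [if_true, Nat.succ_eq_add_one] at *
        omega
      · simp only [if_neg hk] at *
        exact ⟨(Nat.le_add_right _ _).trans h1.1, h1.2⟩
    · rintro ⟨hpos, h'⟩
      have hi : n i = l i + 1 := by
        by_contra hne
        refine h fun k => ?_
        have h1 := h' k
        by_cases hk : k = i
        · subst hk
          simp only [if_true] at h1
          omega
        · simpa only [if_neg hk, Nat.sub_zero] using h1
      intro k
      have h1 := h' k
      have h2 := hn (Nat.le_succ k)
      by_cases hk : k = i
      · subst hk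
        simp only [if_true, Nat.succ_ne_self, if_false] at *
        omega
      · by_cases hk' : k + 1 = i
        · subst hk'
          simp only [if_true, if_neg hk, Nat.succ_eq_add_one] at *
          omega
        · simp only [if_neg hk, if_neg hk'] at *
          omega

open Classical in
/-- The local form of the commutation relation `sum_up_sum_strips`: the two sides count the ways to
reach `nu` from `lam` by adding a box and removing a horizontal strip, in either order. -/
lemma card_filter_up (lam nu : YoungDiagram) :
    ((up lam).filter fun lam' => Interlace lam'.rowLen nu.rowLen).card =
      ((strips nu 1).filter fun rho => Interlace lam.rowLen rho.rowLen).card +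
        if Interlace lam.rowLen nu.rowLen then 1 else 0 := by
  have hl : Antitone lam.rowLen := fun i j => lam.rowLen_anti i j
  have hn : Antitone nu.rowLen := fun i j => nu.rowLen_anti i j
  obtain ⟨N, hN⟩ := exists_rowLen_eq_zero lam
  have hinj : Function.Injective fun i k : ℕ => if k = i then 1 else 0 := by
    intro i j hij
    have := congrFun hij i
    by_contra hne
    simp [hne] at this
  rw [← Set.ncard_coe_finset, ← Set.ncard_coe_finset]
  have e1 : {i | Interlace (fun k => lam.rowLen k + if k = i then 1 else 0) nu.rowLen}.ncard =
      (↑((up lam).filter fun lam' => Interlace lam'.rowLen nu.rowLen) :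
        Set YoungDiagram).ncard := by
    have hex : ∀ i, i ∈ {i | Interlace (fun k => lam.rowLen k + if k = i then 1 else 0)
        nu.rowLen} → ∃ mu : YoungDiagram,
          mu.rowLen = fun k => lam.rowLen k + if k = i then 1 else 0 := by
      intro i hi
      have hi' : Interlace (fun k => lam.rowLen k + if k = i then 1 else 0) nu.rowLen := hi
      refine exists_rowLen_eq hi'.antitone.1 ⟨N + i + 1, ?_⟩
      have := hl (show N ≤ N + i + 1 by omega)
      rw [if_neg (by omega)]
      omega
    choose F hF using hex
    refine Set.ncard_congr F ?_ ?_ ?_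
    · intro i hi
      rw [mem_coe, mem_filter, mem_up_iff_rowLen]
      exact ⟨⟨i, hF i hi⟩, by rw [hF i hi]; exact hi⟩
    · intro i j hi hj hij
      have := (hF i hi).symm.trans ((congrArg _ hij).trans (hF j hj))
      exact hinj (funext fun k => Nat.add_left_cancel (congrFun this k))
    · intro mu hmu
      rw [mem_coe, mem_filter, mem_up_iff_rowLen] at hmu
      obtain ⟨⟨i, hi⟩, h⟩ := hmu
      have hi' : Interlace (fun k => lam.rowLen k + if k = i then 1 else 0) nu.rowLen := hi ▸ h
      exact ⟨i, hi', rowLen_injective ((hF i hi').trans hi.symm)⟩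
  have e2 : {i | 0 < nu.rowLen i ∧
      Interlace lam.rowLen (fun k => nu.rowLen k - if k = i then 1 else 0)}.ncard =
      (↑((strips nu 1).filter fun rho => Interlace lam.rowLen rho.rowLen) :
        Set YoungDiagram).ncard := by
    have hex : ∀ i, i ∈ {i | 0 < nu.rowLen i ∧
        Interlace lam.rowLen (fun k => nu.rowLen k - if k = i then 1 else 0)} →
          ∃ mu : YoungDiagram, mu.rowLen = fun k => nu.rowLen k - if k = i then 1 else 0 := by
      intro i hi
      obtain ⟨N, hN⟩ := exists_rowLen_eq_zero nu
      exact exists_rowLen_eq (Interlace.antitone hi.2).2 ⟨N, by omega⟩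
    choose F hF using hex
    have hF' : ∀ i hi, nu.rowLen = fun k => (F i hi).rowLen k + if k = i then 1 else 0 := by
      intro i hi
      funext k
      rw [hF i hi]
      have := hi.1
      by_cases hk : k = i
      · subst hk; simp only [if_true]; omega
      · simp [hk]
    refine Set.ncard_congr F ?_ ?_ ?_
    · intro i hi
      rw [mem_coe, mem_filter, mem_strips_one, mem_up_iff_rowLen]
      exact ⟨⟨i, hF' i hi⟩, by rw [hF i hi]; exact hi.2⟩
    · intro i j hi hj hij
      have := (hF' i hi).symm.trans (hF' j hj)
      rw [hij] at this
      exact hinj (funext fun k => Nat.add_left_cancel (congrFun this k))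
    · intro mu hmu
      rw [mem_coe, mem_filter, mem_strips_one, mem_up_iff_rowLen] at hmu
      obtain ⟨⟨i, hi⟩, h⟩ := hmu
      have hmu : mu.rowLen = fun k => nu.rowLen k - if k = i then 1 else 0 := by
        funext k; rw [hi]; simp
      have hi' : 0 < nu.rowLen i ∧
          Interlace lam.rowLen (fun k => nu.rowLen k - if k = i then 1 else 0) :=
        ⟨by rw [hi]; simp, hmu ▸ h⟩
      exact ⟨i, hi', rowLen_injective ((hF i hi').trans hmu.symm)⟩
  rw [← e1, ← e2]
  exact ncard_interlace_add hl hn (exists_rowLen_eq_zero nu)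

lemma strips_zero (lam : YoungDiagram) : strips lam 0 = {lam} := by
  ext mu
  rw [mem_strips, mem_singleton]
  constructor
  · rintro ⟨h, hc⟩
    exact YoungDiagram.ext (eq_of_subset_of_card_le (YoungDiagram.cells_subset_iff.2 h.le)
      (by simpa using hc.le))
  · rintro rfl
    exact ⟨fun i => ⟨mu.rowLen_anti _ _ (Nat.le_succ i), le_rfl⟩, rfl⟩

/-- The operators "remove a horizontal strip of `m` boxes" and "add a box" commute up to
"remove a horizontal strip of `m - 1` boxes". For `m = 1` this is the relation `D U = U D + 1` in
Young's lattice; for general `m` it is the inductive step in the proof of the Pieri rule. -/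
lemma sum_up_sum_strips {M : Type*} [AddCommMonoid M] (F : YoungDiagram → M)
    (lam : YoungDiagram) (m : ℕ) :
    ∑ lam' ∈ up lam, ∑ nu ∈ strips lam' m, F nu =
      ∑ rho ∈ strips lam m, ∑ nu ∈ up rho, F nu +
        if 0 < m then ∑ nu ∈ strips lam (m - 1), F nu else 0 := by
  classical
  -- The diagrams `nu` of the right size; comparing the coefficients of `F nu` leaves a count.
  let T := (finite_setOf_card_le (lam.card + 1)).toFinset.filter
    fun nu => lam.card + 1 = nu.card + m
  have hT : ∀ nu, nu ∈ T ↔ lam.card + 1 = nu.card + m := by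
    intro nu
    simp only [T, mem_filter, Set.Finite.mem_toFinset, Set.mem_ofPred_eq]
    omega
  have e1 : ∑ lam' ∈ up lam, ∑ nu ∈ strips lam' m, F nu =
      ∑ nu ∈ T, ∑ lam' ∈ (up lam).filter fun lam' => Interlace lam'.rowLen nu.rowLen, F nu := by
    refine sum_comm' fun lam' nu => ?_
    rw [mem_strips, mem_filter, hT, mem_up]
    constructor
    · rintro ⟨h1, h2, h3⟩; exact ⟨⟨h1, h2⟩, by omega⟩
    · rintro ⟨⟨h1, h2⟩, h3⟩; exact ⟨h1, h2, by omega⟩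
  have e2 : ∑ rho ∈ strips lam m, ∑ nu ∈ up rho, F nu =
      ∑ nu ∈ T, ∑ rho ∈ (strips nu 1).filter fun rho => Interlace lam.rowLen rho.rowLen,
        F nu := by
    refine sum_comm' fun rho nu => ?_
    rw [mem_strips, mem_filter, hT, mem_strips_one, mem_up]
    constructor
    · rintro ⟨⟨h1, h2⟩, h3, h4⟩; exact ⟨⟨⟨h3, h4⟩, h1⟩, by omega⟩
    · rintro ⟨⟨⟨h3, h4⟩, h1⟩, h2⟩; exact ⟨⟨h1, by omega⟩, h3, h4⟩
  have e3 : (if 0 < m then ∑ nu ∈ strips lam (m - 1), F nu else 0) =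
      ∑ nu ∈ T, (if Interlace lam.rowLen nu.rowLen then 1 else 0) • F nu := by
    simp only [ite_smul, one_smul, zero_smul]
    rw [← sum_filter]
    have hcard : ∀ nu : YoungDiagram, Interlace lam.rowLen nu.rowLen → nu.card ≤ lam.card :=
      fun nu h => card_le_card (YoungDiagram.cells_subset_iff.2 h.le)
    split_ifs with hm
    · refine sum_congr ?_ fun _ _ => rfl
      ext nu
      rw [mem_strips, mem_filter, hT]
      constructor
      · rintro ⟨h1, h2⟩; exact ⟨by omega, h1⟩
      · rintro ⟨h1, h2⟩; exact ⟨h2, by omega⟩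
    · refine (sum_eq_zero fun nu hnu => ?_).symm
      rw [mem_filter, hT] at hnu
      have := hcard nu hnu.2
      omega
  rw [e1, e2, e3, ← sum_add_distrib]
  refine sum_congr rfl fun nu _ => ?_
  rw [sum_const, sum_const, card_filter_up, add_smul]

/-! ### Set partitions -/

/-- The partition of `insert a s` obtained from a partition of `s` by adding `a` to the block `o`,
or as a new singleton block if `o = ∅`. Since `∅` is never a block, `insert ∅ P.parts` lists the
possible choices without repetition. -/
def insertInto {α : Type*} [DecidableEq α] {a : α} {s : Finset α} (ha : a ∉ s)
    (P : Finpartition s) (o : Finset α) (ho : o ∈ insert ∅ P.parts) :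
    Finpartition (insert a s) :=
  Finpartition.ofExistsUnique (insert (insert a o) (P.parts.erase o))
    (by
      have hos : o ⊆ s := by
        rcases mem_insert.1 ho with rfl | h
        · exact empty_subset _
        · exact P.le h
      intro p hp
      rcases mem_insert.1 hp with rfl | h
      · exact insert_subset_insert _ hos
      · exact (P.le (mem_of_mem_erase h)).trans (subset_insert _ _))
    (by
      intro x hx
      by_cases hxa : x = a
      · subst hxa
        refine ⟨insert x o, ⟨mem_insert_self _ _, mem_insert_self _ _⟩, ?_⟩
        rintro t ⟨ht, hxt⟩
        rcases mem_insert.1 ht with rfl | h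
        · rfl
        · exact absurd (P.le (mem_of_mem_erase h) hxt) ha
      · have hxs : x ∈ s := (mem_insert.1 hx).resolve_left hxa
        obtain ⟨t, ⟨ht, hxt⟩, huniq⟩ := P.existsUnique_mem hxs
        by_cases hto : t = o
        · subst hto
          refine ⟨insert a t, ⟨mem_insert_self _ _, mem_insert_of_mem hxt⟩, ?_⟩
          rintro u ⟨hu, hxu⟩
          rcases mem_insert.1 hu with rfl | h
          · rfl
          · exact absurd (huniq u ⟨mem_of_mem_erase h, hxu⟩) (ne_of_mem_erase h)
        · refine ⟨t, ⟨mem_insert_of_mem (mem_erase.2 ⟨hto, ht⟩), hxt⟩, ?_⟩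
          rintro u ⟨hu, hxu⟩
          rcases mem_insert.1 hu with rfl | h
          · have hxo : x ∈ o := (mem_insert.1 hxu).resolve_left hxa
            rcases mem_insert.1 ho with rfl | ho
            · exact absurd hxo (notMem_empty _)
            · exact absurd (huniq o ⟨ho, hxo⟩).symm hto
          · exact huniq u ⟨mem_of_mem_erase h, hxu⟩)
    (by
      intro h
      rcases mem_insert.1 h with h | h
      · exact (insert_ne_empty _ _) h.symm
      · exact P.empty_notMem_parts (mem_of_mem_erase h))

lemma parts_insertInto {α : Type*} [DecidableEq α] {a : α} {s : Finset α} (ha : a ∉ s)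
    (P : Finpartition s) (o : Finset α) (ho : o ∈ insert ∅ P.parts) :
    (insertInto ha P o ho).parts = insert (insert a o) (P.parts.erase o) := rfl

lemma notMem_of_mem_parts {α : Type*} [DecidableEq α] {a : α} {s : Finset α} (ha : a ∉ s)
    {P : Finpartition s} {o : Finset α} (ho : o ∈ insert ∅ P.parts) : a ∉ o := by
  rcases mem_insert.1 ho with rfl | h
  · exact notMem_empty _
  · exact fun h' => ha (P.le h h')

lemma card_insertInto {α : Type*} [DecidableEq α] {a : α} {s : Finset α} (ha : a ∉ s)
    (P : Finpartition s) (o : Finset α) (ho : o ∈ insert ∅ P.parts) :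
    (insertInto ha P o ho).parts.card = if o = ∅ then P.parts.card + 1 else P.parts.card := by
  have hnot : insert a o ∉ P.parts.erase o := fun h =>
    ha (P.le (mem_of_mem_erase h) (mem_insert_self _ _))
  rw [parts_insertInto, card_insert_of_notMem hnot]
  split_ifs with h
  · rw [erase_eq_of_notMem (h ▸ P.empty_notMem_parts)]
  · exact card_erase_add_one ((mem_insert.1 ho).resolve_left h)

/-- Every partition of `insert a s` arises in exactly one way from a partition of `s`, by making `a`
a new block or by adding it to one of the blocks. -/
lemma sum_finpartition_insert {α : Type*} [DecidableEq α] {a : α} {s : Finset α} (ha : a ∉ s)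
    {M : Type*} [AddCommMonoid M] (F : ℕ → M) :
    ∑ P : Finpartition (insert a s), F P.parts.card =
      ∑ P : Finpartition s, (F (P.parts.card + 1) + P.parts.card • F P.parts.card) := by
  have key : ∑ x ∈ (univ : Finset (Finpartition s)).sigma fun P => insert ∅ P.parts,
      F (if x.2 = ∅ then x.1.parts.card + 1 else x.1.parts.card) =
        ∑ P : Finpartition (insert a s), F P.parts.card := by
    refine sum_bij (fun x hx => insertInto ha x.1 x.2 (mem_sigma.1 hx).2)
      (fun _ _ => mem_univ _) ?_ ?_ ?_
    · rintro ⟨P, o⟩ hx ⟨P', o'⟩ hx' h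
      have ho := (mem_sigma.1 hx).2
      have ho' := (mem_sigma.1 hx').2
      simp only at ho ho' h
      have hao := notMem_of_mem_parts ha ho
      have hao' := notMem_of_mem_parts ha ho'
      have hparts := congrArg Finpartition.parts h
      rw [parts_insertInto, parts_insertInto] at hparts
      have hnot : ∀ (Q : Finpartition s) (u v : Finset α), insert a u ∉ Q.parts.erase v :=
        fun Q u v h => ha (Q.le (mem_of_mem_erase h) (mem_insert_self _ _))
      obtain rfl : o = o' := by
        have h1 : insert a o ∈ insert (insert a o') (P'.parts.erase o') :=
          hparts ▸ mem_insert_self _ _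
        have h2 := (mem_insert.1 h1).resolve_right (hnot P' o o')
        rw [← erase_insert hao, h2, erase_insert hao']
      have h3 : P.parts.erase o = P'.parts.erase o := by
        rw [← erase_insert (hnot P o o), hparts, erase_insert (hnot P' o o)]
      obtain rfl : P = P' := by
        refine Finpartition.ext ?_
        by_cases hoe : o = ∅
        · rwa [erase_eq_of_notMem (hoe ▸ P.empty_notMem_parts),
            erase_eq_of_notMem (hoe ▸ P'.empty_notMem_parts)] at h3
        · rw [← insert_erase ((mem_insert.1 ho).resolve_left hoe), h3,
            insert_erase ((mem_insert.1 ho').resolve_left hoe)]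
      rfl
    · intro Q _
      have haQ : a ∈ Q.part a := Q.mem_part_self.2 (mem_insert_self _ _)
      have hpart : Q.part a ∈ Q.parts := Q.part_mem.2 (mem_insert_self _ _)
      -- The inverse map deletes `a` from its block.
      let P : Finpartition s := (Q.avoid {a}).copy (by
        rw [sdiff_singleton_eq_erase, erase_insert ha])
      have hP : ∀ c, c ∈ P.parts ↔ ∃ d ∈ Q.parts, ¬ d ⊆ {a} ∧ d \ {a} = c :=
        fun c => Finpartition.mem_avoid Q
      have hne : ∀ d ∈ Q.parts, d ≠ Q.part a → a ∉ d := fun d hd hda had =>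
        hda (Q.eq_of_mem_parts hd hpart had haQ)
      have ho : (Q.part a).erase a ∈ insert ∅ P.parts := by
        rw [mem_insert, hP]
        by_cases h : Q.part a ⊆ {a}
        · left
          rw [← sdiff_singleton_eq_erase, sdiff_eq_empty_iff_subset]
          exact h
        · exact Or.inr ⟨_, hpart, h, sdiff_singleton_eq_erase _ _⟩
      refine ⟨⟨P, (Q.part a).erase a⟩, mem_sigma.2 ⟨mem_univ _, ho⟩, ?_⟩
      refine Finpartition.ext ?_
      rw [parts_insertInto, insert_erase haQ]
      ext c
      rw [mem_insert, mem_erase, hP]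
      constructor
      · rintro (rfl | ⟨hc, d, hd, hda, rfl⟩)
        · exact hpart
        · by_cases hdp : d = Q.part a
          · rw [hdp, sdiff_singleton_eq_erase] at hc
            exact absurd rfl hc
          · rwa [sdiff_singleton_eq_erase, erase_eq_of_notMem (hne d hd hdp)]
      · intro hc
        by_cases hcp : c = Q.part a
        · exact Or.inl hcp
        · have hac := hne c hc hcp
          obtain ⟨x, hx⟩ := Q.nonempty_of_mem_parts hc
          refine Or.inr ⟨?_, c, hc, ?_, ?_⟩
          · rintro rfl
            exact hcp (Q.eq_of_mem_parts hc hpart hx (mem_of_mem_erase hx))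
          · intro hca
            obtain rfl := mem_singleton.1 (hca hx)
            exact hac hx
          · rw [sdiff_singleton_eq_erase, erase_eq_of_notMem hac]
    · rintro ⟨P, o⟩ hx
      rw [card_insertInto]
  rw [← key, sum_sigma]
  refine sum_congr rfl fun P _ => ?_
  rw [sum_insert P.empty_notMem_parts, if_pos rfl]
  congr 1
  rw [← sum_const]
  exact sum_congr rfl fun o ho => by rw [if_neg (P.ne_empty ho)]

lemma sum_finpartition_empty {α : Type*} [DecidableEq α] {M : Type*} [AddCommMonoid M]
    (F : ℕ → M) : ∑ P : Finpartition (∅ : Finset α), F P.parts.card = F 0 := by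
  have h : ∀ P : Finpartition (∅ : Finset α), P.parts.card = 0 := fun P =>
    card_eq_zero.2 (P.parts_eq_empty_iff.2 rfl)
  have : Unique (Finpartition (∅ : Finset α)) :=
    inferInstanceAs (Unique (Finpartition (⊥ : Finset α)))
  rw [sum_congr rfl fun P _ => by rw [h P], sum_const, card_univ, Fintype.card_unique, one_smul]

lemma S_eq_card (k j : ℕ) :
    S k j = (univ.filter fun P : Finpartition (univ : Finset (Fin k)) =>
      P.parts.card = j).card := by
  rw [S, ← Set.ncard_coe_finset]
  simp

lemma card_parts_le {k : ℕ} (P : Finpartition (univ : Finset (Fin k))) : P.parts.card ≤ k := by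
  simpa using P.card_parts_le_card

lemma S_eq_zero {k j : ℕ} (h : k < j) : S k j = 0 := by
  rw [S_eq_card, card_eq_zero, filter_eq_empty_iff]
  intro P _
  have := card_parts_le P
  omega

lemma sum_S {k : ℕ} {M : Type*} [AddCommMonoid M] (F : ℕ → M) :
    ∑ P : Finpartition (univ : Finset (Fin k)), F P.parts.card =
      ∑ j ∈ range (k + 1), S k j • F j := by
  rw [← sum_fiberwise_of_maps_to (t := range (k + 1)) (g := fun P => P.parts.card)
    fun P _ => mem_range.2 (Nat.lt_succ_of_le (card_parts_le P))]
  refine sum_congr rfl fun j _ => ?_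
  rw [S_eq_card, ← sum_const]
  exact sum_congr rfl fun P hP => by rw [(mem_filter.1 hP).2]

lemma B_eq_sum_choose (k j : ℕ) :
    B k j = ∑ P : Finpartition (univ : Finset (Fin k)), P.parts.card.choose j := by
  have : {Q : Finpartition (univ : Finset (Fin k)) × Finset (Finset (Fin k)) |
      Q.2 ⊆ Q.1.parts ∧ Q.2.card = j} = ↑(((univ : Finset (Finpartition (univ :
        Finset (Fin k)))).sigma fun P => P.parts.powersetCard j).map
          (Equiv.sigmaEquivProd _ _).toEmbedding) := by
    ext ⟨P, Q⟩
    simp [mem_powersetCard]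
  rw [B, this, Set.ncard_coe_finset, card_map, card_sigma]
  exact sum_congr rfl fun P _ => card_powersetCard _ _

/-- Marking some of the blocks replaces `x` by `1 + x` in the generating function of set partitions
by the number of blocks. -/
lemma sum_B {k : ℕ} {A : Type*} [CommSemiring A] (x : A) :
    ∑ j ∈ range (k + 1), (B k j : A) * x ^ j =
      ∑ P : Finpartition (univ : Finset (Fin k)), (1 + x) ^ P.parts.card := by
  simp only [B_eq_sum_choose, Nat.cast_sum, sum_mul]
  rw [sum_comm]
  refine sum_congr rfl fun P _ => ?_
  rw [add_comm 1 x, add_pow]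
  have hsub : range (P.parts.card + 1) ⊆ range (k + 1) :=
    range_subset_range.2 (Nat.succ_le_succ (card_parts_le P))
  rw [← sum_subset hsub]
  · exact sum_congr rfl fun j _ => by rw [one_pow, mul_one, mul_comm]
  · intro j _ hj
    rw [mem_range, not_lt] at hj
    rw [Nat.choose_eq_zero_of_lt hj, Nat.cast_zero, zero_mul]

/-- By the commutation relation, `X * (1 + D)` maps `X ^ n • e` to `X ^ (n + 1) • e + n • X ^ n • e`.
This mirrors the insertion of a new element into a set partition with `n` blocks: it forms a new
block, or joins one of the `n` blocks. -/
lemma pow_apply_eq_sum_finpartition {V : Type*} [AddCommMonoid V] (D X : Module.End ℕ V)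
    (hDX : D * X = X * D + 1) {e : V} (he : D e = 0) {α : Type*} [DecidableEq α]
    (s : Finset α) :
    ((X * (1 + D)) ^ s.card) e = ∑ P : Finpartition s, (X ^ P.parts.card) e := by
  have hcomm : ∀ n : ℕ, X * D * X ^ n = X ^ (n + 1) * D + n • X ^ n := by
    intro n
    induction n with
    | zero => simp
    | succ n ih =>
      have h1 : X * D * X = X * (X * D) + X := by rw [mul_assoc, hDX, mul_add, mul_one]
      calc X * D * X ^ (n + 1) = X * (X * D * X ^ n) + X * X ^ n := by
            rw [pow_succ', ← mul_assoc, h1, add_mul, mul_assoc X (X * D)]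
        _ = X ^ (n + 1 + 1) * D + (n + 1) • X ^ (n + 1) := by
            rw [ih, mul_add, ← mul_assoc, ← pow_succ', ← pow_succ', mul_smul_comm, ← pow_succ',
              add_smul, one_smul, add_assoc]
  have hstep : ∀ n : ℕ, (X * (1 + D)) ((X ^ n) e) = (X ^ (n + 1)) e + n • (X ^ n) e := by
    intro n
    rw [mul_add, mul_one, LinearMap.add_apply, ← Module.End.mul_apply, ← pow_succ',
      ← Module.End.mul_apply (X * D), hcomm, LinearMap.add_apply, Module.End.mul_apply, he,
      map_zero, zero_add, LinearMap.smul_apply]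
  induction s using Finset.induction_on with
  | empty => rw [sum_finpartition_empty fun n => (X ^ n) e, card_empty, pow_zero, pow_zero]
  | insert a s ha ih =>
    rw [card_insert_of_notMem ha, pow_succ', Module.End.mul_apply, ih, map_sum,
      sum_finpartition_insert ha fun n => (X ^ n) e]
    exact sum_congr rfl fun P _ => hstep _

/-! ### Counting semistandard tableaux one value at a time -/

/-- Counting a set that is the disjoint union of injective images of the sets `X i`. -/
lemma finite_and_ncard_eq_sum {α ι β : Type*} {s : Set α} {t : Finset ι} {X : ι → Set β}
    (hX : ∀ i, (X i).Finite) (e : ι → β → α) (hmap : ∀ i ∈ t, ∀ x ∈ X i, e i x ∈ s)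
    (hinj : ∀ i ∈ t, ∀ x ∈ X i, ∀ j ∈ t, ∀ y ∈ X j, e i x = e j y → i = j ∧ x = y)
    (hsurj : ∀ a ∈ s, ∃ i ∈ t, ∃ x ∈ X i, e i x = a) :
    s.Finite ∧ s.ncard = ∑ i ∈ t, (X i).ncard := by
  classical
  let u : Finset (Σ _ : ι, β) := t.sigma fun i => (hX i).toFinset
  have hu : ∀ i x, (⟨i, x⟩ : Σ _ : ι, β) ∈ u ↔ i ∈ t ∧ x ∈ X i := fun i x => by simp [u]
  have hs : s = ↑(u.image fun z => e z.1 z.2) := by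
    ext a
    rw [mem_coe, mem_image]
    constructor
    · intro ha
      obtain ⟨i, hi, x, hx, rfl⟩ := hsurj a ha
      exact ⟨⟨i, x⟩, (hu i x).2 ⟨hi, hx⟩, rfl⟩
    · rintro ⟨⟨i, x⟩, hz, rfl⟩
      exact hmap i ((hu i x).1 hz).1 x ((hu i x).1 hz).2
  refine ⟨hs ▸ Finset.finite_toSet _, ?_⟩
  rw [hs, Set.ncard_coe_finset, card_image_of_injOn, card_sigma]
  · exact sum_congr rfl fun i _ => (Set.ncard_eq_toFinset_card _ (hX i)).symm
  · rintro ⟨i, x⟩ hz ⟨j, y⟩ hz' h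
    obtain ⟨h1, h2⟩ := (hu i x).1 hz
    obtain ⟨h3, h4⟩ := (hu j y).1 hz'
    obtain ⟨rfl, rfl⟩ := hinj i h1 x h2 j h3 y h4 h
    rfl

/-- The semistandard Young tableaux of shape `lam` with entries in `1, …, n` in which the entry
`k + 1` appears `d k` times, for `k < n`. They are encoded by their entry functions, so that tableaux
of different shapes live in one type. -/
def tableaux (n : ℕ) (lam : YoungDiagram) (d : ℕ → ℕ) : Set (ℕ → ℕ → ℕ) :=
  {f | (∀ i j1 j2, j1 < j2 → (i, j2) ∈ lam → f i j1 ≤ f i j2) ∧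
    (∀ i1 i2 j, i1 < i2 → (i2, j) ∈ lam → f i1 j < f i2 j) ∧
    (∀ i j, (i, j) ∉ lam → f i j = 0) ∧
    (∀ i j, (i, j) ∈ lam → 0 < f i j ∧ f i j ≤ n) ∧
    ∀ k < n, (lam.cells.filter fun c => f c.1 c.2 = k + 1).card = d k}

/-- Fill the cells of `lam` outside `mu` with the entry `m`. -/
def fillStrip (m : ℕ) (lam mu : YoungDiagram) (f : ℕ → ℕ → ℕ) (i j : ℕ) : ℕ :=
  if (i, j) ∈ mu then f i j else if (i, j) ∈ lam then m else 0

lemma fillStrip_mem {n : ℕ} {lam mu : YoungDiagram} {d : ℕ → ℕ} {f : ℕ → ℕ → ℕ}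
    (hmu : mu ∈ strips lam (d n)) (hf : f ∈ tableaux n mu d) :
    fillStrip (n + 1) lam mu f ∈ tableaux (n + 1) lam d := by
  obtain ⟨hI, hcard⟩ := mem_strips.1 hmu
  obtain ⟨hle, hstrip⟩ := interlace_iff.1 hI
  obtain ⟨hrow, hcol, hzero, hbd, hmult⟩ := hf
  have hin : ∀ {i j}, (i, j) ∈ mu → fillStrip (n + 1) lam mu f i j = f i j := fun h => if_pos h
  have hout : ∀ {i j}, (i, j) ∈ lam → (i, j) ∉ mu → fillStrip (n + 1) lam mu f i j = n + 1 :=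
    fun h h' => (if_neg h').trans (if_pos h)
  have hbd' : ∀ i j, (i, j) ∈ lam →
      0 < fillStrip (n + 1) lam mu f i j ∧ fillStrip (n + 1) lam mu f i j ≤ n + 1 := by
    intro i j h
    by_cases hm : (i, j) ∈ mu
    · rw [hin hm]; have := hbd i j hm; omega
    · rw [hout h hm]; omega
  refine ⟨?_, ?_, ?_, hbd', ?_⟩
  · intro i j1 j2 hj h2
    have h1 := lam.up_left_mem le_rfl hj.le h2
    by_cases hm : (i, j2) ∈ mu
    · rw [hin hm, hin (mu.up_left_mem le_rfl hj.le hm)]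
      exact hrow i j1 j2 hj hm
    · rw [hout h2 hm]
      exact (hbd' i j1 h1).2
  · intro i1 i2 j hi h2
    have h1 : (i1, j) ∈ mu := hstrip _ _ (lam.up_left_mem hi le_rfl h2)
    rw [hin h1]
    by_cases hm : (i2, j) ∈ mu
    · rw [hin hm]
      exact hcol i1 i2 j hi hm
    · rw [hout h2 hm]
      exact Nat.lt_succ_of_le (hbd i1 j h1).2
  · intro i j h
    rw [fillStrip, if_neg fun h' => h (hle h'), if_neg h]
  · intro k hk
    rcases Nat.lt_succ_iff_lt_or_eq.1 hk with hk | rfl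
    · rw [← hmult k hk]
      congr 1
      ext ⟨i, j⟩
      rw [mem_filter, mem_filter, YoungDiagram.mem_cells, YoungDiagram.mem_cells]
      constructor
      · rintro ⟨h1, h2⟩
        by_cases hm : (i, j) ∈ mu
        · exact ⟨hm, (hin hm).symm.trans h2⟩
        · have := (hout h1 hm).symm.trans h2
          omega
      · rintro ⟨h1, h2⟩
        exact ⟨hle h1, (hin h1).trans h2⟩
    · have : (lam.cells.filter fun c => fillStrip (k + 1) lam mu f c.1 c.2 = k + 1) =
          lam.cells \ mu.cells := by
        ext ⟨i, j⟩
        rw [mem_filter, mem_sdiff, YoungDiagram.mem_cells, YoungDiagram.mem_cells]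
        refine and_congr_right fun h1 => ⟨fun h2 hm => ?_, fun h2 => hout h1 h2⟩
        have := (hin hm).symm.trans h2
        have := (hbd i j hm).2
        omega
      rw [this, card_sdiff_of_subset (YoungDiagram.cells_subset_iff.2 hle)]
      exact Nat.sub_eq_of_eq_add' hcard

lemma exists_fillStrip_eq {n : ℕ} {lam : YoungDiagram} {d : ℕ → ℕ} {f : ℕ → ℕ → ℕ}
    (hf : f ∈ tableaux (n + 1) lam d) :
    ∃ mu ∈ strips lam (d n), ∃ f' ∈ tableaux n mu d, fillStrip (n + 1) lam mu f' = f := by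
  obtain ⟨hrow, hcol, hzero, hbd, hmult⟩ := hf
  let mu : YoungDiagram :=
    { cells := lam.cells.filter fun c => f c.1 c.2 ≤ n
      isLowerSet := by
        rintro ⟨i, j⟩ ⟨i', j'⟩ hle h
        obtain ⟨h1, h2⟩ := Prod.mk_le_mk.1 hle
        simp only [coe_filter, YoungDiagram.mem_cells, Set.mem_ofPred_eq] at h ⊢
        have h3 := lam.up_left_mem le_rfl h2 h.1
        refine ⟨lam.up_left_mem h1 le_rfl h3, ?_⟩
        have h4 : f i j' ≤ f i j := by
          rcases h2.eq_or_lt with rfl | h2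
          · exact le_rfl
          · exact hrow i j' j h2 h.1
        have h5 : f i' j' ≤ f i j' := by
          rcases h1.eq_or_lt with rfl | h1
          · exact le_rfl
          · exact (hcol i' i j' h1 h3).le
        exact (h5.trans h4).trans h.2 }
  have hmem : ∀ {i j}, (i, j) ∈ mu ↔ (i, j) ∈ lam ∧ f i j ≤ n := fun {i j} => by
    rw [← YoungDiagram.mem_cells, mem_filter, YoungDiagram.mem_cells]
  have hle : mu ≤ lam := fun c hc => (hmem.1 hc).1
  obtain ⟨f', hin, hout⟩ : ∃ f' : ℕ → ℕ → ℕ, (∀ {i j}, (i, j) ∈ mu → f' i j = f i j) ∧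
      ∀ i j, (i, j) ∉ mu → f' i j = 0 :=
    ⟨fun i j => if (i, j) ∈ mu then f i j else 0, fun h => if_pos h, fun i j h => if_neg h⟩
  refine ⟨mu, mem_strips.2 ⟨interlace_iff.2 ⟨hle, fun i j h => hmem.2
    ⟨lam.up_left_mem (Nat.le_succ i) le_rfl h, ?_⟩⟩, ?_⟩,
    f', ⟨?_, ?_, hout, ?_, ?_⟩, ?_⟩
  · have := hcol i (i + 1) j (Nat.lt_succ_self i) h
    have := (hbd _ _ h).2
    omega
  · have hd := hmult n (Nat.lt_succ_self n)
    have hsplit := card_filter_add_card_filter_not (s := lam.cells) fun c => f c.1 c.2 ≤ n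
    have : (lam.cells.filter fun c => ¬ f c.1 c.2 ≤ n) =
        lam.cells.filter fun c => f c.1 c.2 = n + 1 := by
      refine filter_congr fun c hc => ?_
      have := (hbd c.1 c.2 hc).2
      omega
    rw [this, hd] at hsplit
    exact hsplit.symm
  · intro i j1 j2 hj h
    rw [hin h, hin (mu.up_left_mem le_rfl hj.le h)]
    exact hrow i j1 j2 hj (hle h)
  · intro i1 i2 j hi h
    rw [hin h, hin (mu.up_left_mem hi.le le_rfl h)]
    exact hcol i1 i2 j hi (hle h)
  · intro i j h
    rw [hin h]
    exact ⟨(hbd i j (hle h)).1, (hmem.1 h).2⟩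
  · intro k hk
    rw [← hmult k (hk.trans (Nat.lt_succ_self n))]
    congr 1
    ext ⟨i, j⟩
    refine mem_filter.trans (Iff.trans ?_ mem_filter.symm)
    constructor
    · rintro ⟨h1, h2⟩
      exact ⟨hle h1, (hin h1).symm.trans h2⟩
    · rintro ⟨h1, h2⟩
      have h3 : (i, j) ∈ mu := hmem.2 ⟨h1, by simp only at h2; omega⟩
      exact ⟨h3, (hin h3).trans h2⟩
  · funext i j
    rw [fillStrip]
    split_ifs with h1 h2
    · exact hin h1
    · have := (hbd i j h2).2
      have : ¬ f i j ≤ n := fun h => h1 (hmem.2 ⟨h2, h⟩)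
      omega
    · exact (hzero i j h2).symm

lemma fillStrip_injective {n : ℕ} {lam mu mu' : YoungDiagram} {d : ℕ → ℕ} {f f' : ℕ → ℕ → ℕ}
    (hmu : mu ∈ strips lam (d n)) (hf : f ∈ tableaux n mu d)
    (hmu' : mu' ∈ strips lam (d n)) (hf' : f' ∈ tableaux n mu' d)
    (h : fillStrip (n + 1) lam mu f = fillStrip (n + 1) lam mu' f') : mu = mu' ∧ f = f' := by
  have hmem : ∀ {nu : YoungDiagram} {g : ℕ → ℕ → ℕ}, nu ∈ strips lam (d n) →
      g ∈ tableaux n nu d → ∀ i j, (i, j) ∈ nu ↔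
        (i, j) ∈ lam ∧ fillStrip (n + 1) lam nu g i j ≤ n := by
    intro nu g hnu hg i j
    obtain ⟨hI, -⟩ := mem_strips.1 hnu
    constructor
    · intro hm
      rw [fillStrip, if_pos hm]
      exact ⟨hI.le hm, (hg.2.2.2.1 i j hm).2⟩
    · rintro ⟨h1, h2⟩
      by_contra hm
      rw [fillStrip, if_neg hm, if_pos h1] at h2
      omega
  obtain rfl : mu = mu' := by
    refine YoungDiagram.ext (Finset.ext fun ⟨i, j⟩ => ?_)
    rw [YoungDiagram.mem_cells, YoungDiagram.mem_cells, hmem hmu hf, hmem hmu' hf', h]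
  refine ⟨rfl, funext₂ fun i j => ?_⟩
  by_cases hm : (i, j) ∈ mu
  · have := congrFun₂ h i j
    rwa [fillStrip, fillStrip, if_pos hm, if_pos hm] at this
  · rw [hf.2.2.1 i j hm, hf'.2.2.1 i j hm]

lemma tableaux_zero_finite (lam : YoungDiagram) (d : ℕ → ℕ) : (tableaux 0 lam d).Finite := by
  refine (Set.finite_singleton (fun _ _ => 0)).subset fun f hf => ?_
  refine funext₂ fun i j => hf.2.2.1 i j fun h => ?_
  have := hf.2.2.2.1 i j h
  omega

lemma tableaux_finite (n : ℕ) (lam : YoungDiagram) (d : ℕ → ℕ) : (tableaux n lam d).Finite := by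
  induction n generalizing lam with
  | zero => exact tableaux_zero_finite lam d
  | succ n ih =>
    exact (finite_and_ncard_eq_sum (fun mu => ih mu) (fillStrip (n + 1) lam)
      (fun _ h _ h' => fillStrip_mem h h')
      (fun _ h _ h' _ h'' _ h''' => fillStrip_injective h h' h'' h''')
      (fun _ h => exists_fillStrip_eq h)).1

/-- The Kostka number: the number of semistandard tableaux of shape `lam` with entries in
`1, …, n` in which `k + 1` appears `d k` times. -/
def kostka (n : ℕ) (lam : YoungDiagram) (d : ℕ → ℕ) : ℕ := (tableaux n lam d).ncard

lemma kostka_succ (n : ℕ) (lam : YoungDiagram) (d : ℕ → ℕ) :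
    kostka (n + 1) lam d = ∑ mu ∈ strips lam (d n), kostka n mu d :=
  (finite_and_ncard_eq_sum (fun mu => tableaux_finite n mu d) (fillStrip (n + 1) lam)
    (fun _ h _ h' => fillStrip_mem h h')
    (fun _ h _ h' _ h'' _ h''' => fillStrip_injective h h' h'' h''')
    (fun _ h => exists_fillStrip_eq h)).2

lemma kostka_congr {n : ℕ} (lam : YoungDiagram) {d d' : ℕ → ℕ} (h : ∀ k < n, d k = d' k) :
    kostka n lam d = kostka n lam d' := by
  have : tableaux n lam d = tableaux n lam d' := by
    ext f
    refine and_congr_right fun _ => and_congr_right fun _ => and_congr_right fun _ =>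
      and_congr_right fun _ => forall₂_congr fun k hk => ?_
    rw [h k hk]
  rw [kostka, this, kostka]

/-! ### The Pieri rule -/

/-- The Pieri rule for multiplication by `h_1`, in terms of Kostka numbers. The induction removes
the largest entry from the tableaux; the step is the commutation of adding a box with removing a
horizontal strip. -/
lemma sum_up_kostka (n : ℕ) (lam : YoungDiagram) (d : ℕ → ℕ) :
    ∑ lam' ∈ up lam, kostka n lam' d =
      ∑ i ∈ range n, if 0 < d i then
        kostka n lam (fun k => d k - if k = i then 1 else 0) else 0 := by
  induction n generalizing lam with
  | zero =>
    rw [range_zero, sum_empty]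
    refine sum_eq_zero fun lam' h => ?_
    rw [kostka, Set.ncard_eq_zero (tableaux_finite _ _ _), Set.eq_empty_iff_forall_notMem]
    intro f hf
    have hpos : 0 < lam'.cells.card := by
      have := (mem_up.1 h).2
      exact Nat.pos_of_ne_zero fun h0 => by
        rw [YoungDiagram.card, h0] at this; omega
    obtain ⟨⟨i, j⟩, hc⟩ := card_pos.1 hpos
    have := hf.2.2.2.1 i j hc
    omega
  | succ n ih =>
    simp only [kostka_succ]
    rw [sum_up_sum_strips fun nu => kostka n nu d, sum_range_succ]
    congr 1
    · simp only [ih]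
      rw [sum_comm]
      refine sum_congr rfl fun i hi => ?_
      have hni : n ≠ i := (mem_range.1 hi).ne'
      split_ifs with h
      · rw [Nat.sub_zero]
      · exact sum_const_zero
    · simp only [if_true]
      split_ifs with h
      · refine sum_congr rfl fun nu _ => kostka_congr nu fun k hk => ?_
        rw [if_neg hk.ne, Nat.sub_zero]
      · rfl

/-- A coefficient of a Schur function only involves tableaux with entries in a finite range: if `d` is
supported in `1, …, n`, then so are the entries of every tableau of content `d`. -/
lemma coeff_schur (R : Type*) [CommRing R] (mu : YoungDiagram) {n : ℕ} {d : ℕ+ →₀ ℕ}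
    (hd : ∀ i : ℕ+, n < (i : ℕ) → d i = 0) :
    MvPowerSeries.coeff d (schur R mu) = (kostka n mu fun k => d k.succPNat : ℕ) := by
  change (Set.ncard _ : R) = _
  congr 1
  rw [kostka, ← Set.ncard_image_of_injective _ (DFunLike.coe_injective)]
  congr 1
  ext f
  constructor
  · rintro ⟨T, ⟨hpos, hmult⟩, rfl⟩
    refine ⟨fun i j1 j2 hj h => T.row_weak hj h, fun i1 i2 j hi h => T.col_strict hi h,
      fun i j h => T.zeros h, fun i j h => ⟨hpos (i, j) h, ?_⟩, fun k _ => hmult k.succPNat⟩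
    by_contra! hlt
    have h1 : mult T (T i j) = 0 :=
      (hmult ⟨T i j, hpos (i, j) h⟩).trans (hd ⟨T i j, hpos (i, j) h⟩ hlt)
    rw [mult, card_eq_zero, filter_eq_empty_iff] at h1
    exact h1 (x := (i, j)) h rfl
  · rintro ⟨hrow, hcol, hzero, hbd, hmult⟩
    let T : SemistandardYoungTableau mu :=
      ⟨f, fun {i j1 j2} => hrow i j1 j2, fun {i1 i2 j} => hcol i1 i2 j, fun {i j} => hzero i j⟩
    refine ⟨T, ⟨fun c hc => (hbd c.1 c.2 hc).1, fun i => ?_⟩, rfl⟩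
    by_cases hi : (i : ℕ) ≤ n
    · have h1 := hmult i.natPred (by have := i.natPred_add_one; omega)
      simp only [PNat.succPNat_natPred, PNat.natPred_add_one] at h1
      exact h1
    · rw [hd i (not_le.1 hi), mult, card_eq_zero, filter_eq_empty_iff]
      intro c hc h
      have h1 : f c.1 c.2 = i := h
      have := (hbd c.1 c.2 hc).2
      omega

lemma coeff_h1_mul (R : Type*) [CommRing R] (F : MvPowerSeries ℕ+ R) (d : ℕ+ →₀ ℕ) :
    MvPowerSeries.coeff d (h1 R * F) =
      ∑ i ∈ d.support, MvPowerSeries.coeff (d - Finsupp.single i 1) F := by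
  classical
  rw [MvPowerSeries.coeff_mul]
  have hh : ∀ a : ℕ+ →₀ ℕ, MvPowerSeries.coeff a (h1 R) =
      if ∃ i : ℕ+, a = Finsupp.single i 1 then 1 else 0 := by
    intro a
    change (if _ then _ else _) = _
    congr
  simp only [hh, ite_mul, one_mul, zero_mul]
  rw [← sum_filter]
  symm
  have hle : ∀ i ∈ d.support, Finsupp.single i 1 ≤ d := fun i hi =>
    Finsupp.single_le_iff.2 (Nat.one_le_iff_ne_zero.2 (Finsupp.mem_support_iff.1 hi))
  refine sum_bij (fun i _ => (Finsupp.single i 1, d - Finsupp.single i 1)) ?_ ?_ ?_ ?_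
  · intro i hi
    rw [mem_filter, HasAntidiagonal.mem_antidiagonal]
    exact ⟨add_tsub_cancel_of_le (hle i hi), i, rfl⟩
  · intro i _ j _ h
    exact Finsupp.single_left_injective one_ne_zero (Prod.ext_iff.1 h).1
  · rintro ⟨a, b⟩ h
    rw [mem_filter, HasAntidiagonal.mem_antidiagonal] at h
    obtain ⟨hab, i, rfl⟩ := h
    simp only at hab
    refine ⟨i, ?_, ?_⟩
    · rw [Finsupp.mem_support_iff, ← hab]
      simp
    · rw [← hab, add_tsub_cancel_left]
  · intro i _
    rfl

lemma sum_up_schur (R : Type*) [CommRing R] (mu : YoungDiagram) :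
    ∑ lam ∈ up mu, schur R lam = h1 R * schur R mu := by
  ext d
  let n := d.support.sup fun i : ℕ+ => (i : ℕ)
  have hd : ∀ i : ℕ+, n < (i : ℕ) → d i = 0 := by
    intro i hi
    by_contra h
    have : (i : ℕ) ≤ n := le_sup (f := fun i : ℕ+ => (i : ℕ)) (Finsupp.mem_support_iff.2 h)
    omega
  rw [map_sum, coeff_h1_mul, sum_congr rfl fun lam _ => coeff_schur R lam hd, ← Nat.cast_sum,
    sum_up_kostka, ← sum_filter, Nat.cast_sum]
  refine sum_bij (fun k _ => k.succPNat) ?_ ?_ ?_ ?_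
  · intro k hk
    exact Finsupp.mem_support_iff.2 (mem_filter.1 hk).2.ne'
  · intro k _ l _ h
    exact Nat.succPNat_injective h
  · intro i hi
    have h0 := Finsupp.mem_support_iff.1 hi
    refine ⟨i.natPred, ?_, PNat.succPNat_natPred i⟩
    rw [mem_filter, PNat.succPNat_natPred, mem_range]
    refine ⟨?_, Nat.pos_of_ne_zero h0⟩
    have h1 : (i : ℕ) ≤ n := by
      by_contra! h
      exact h0 (hd i h)
    have := i.natPred_add_one
    omega
  · intro k _
    rw [coeff_schur R mu (n := n) fun i hi => by
      rw [Finsupp.tsub_apply, hd i hi, Nat.zero_sub]]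
    congr 2
    funext l
    rw [Finsupp.tsub_apply, Finsupp.single_apply]
    simp only [Nat.succPNat_inj, eq_comm]

lemma schur_bot (R : Type*) [CommRing R] : schur R ⊥ = 1 := by
  classical
  ext d
  rw [MvPowerSeries.coeff_one]
  have hmult : ∀ (T : SemistandardYoungTableau ⊥) (i : ℕ), mult T i = 0 := fun T i => by
    simp [mult]
  change ((Set.ncard _ : ℕ) : R) = _
  split_ifs with h
  · subst h
    have : Subsingleton (SemistandardYoungTableau ⊥) :=
      ⟨fun T T' => SemistandardYoungTableau.ext fun i j => by
        rw [T.zeros (YoungDiagram.notMem_bot _), T'.zeros (YoungDiagram.notMem_bot _)]⟩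
    rw [Set.ncard_eq_one.2 ⟨default, ?_⟩, Nat.cast_one]
    ext T
    simp [hmult, Subsingleton.elim T default]
  · suffices he : {T : SemistandardYoungTableau ⊥ | (∀ c ∈ (⊥ : YoungDiagram).cells,
        0 < T c.1 c.2) ∧ ∀ i : ℕ+, mult T (i : ℕ) = d i} = ∅ by
      rw [he, Set.ncard_empty, Nat.cast_zero]
    rw [Set.eq_empty_iff_forall_notMem]
    rintro T ⟨-, hT⟩
    exact h (Finsupp.ext fun i => (hT i).symm.trans (hmult T i))

/-! ### Vacillating tableaux as walks in Young's lattice -/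

/-- The operator that maps a diagram to the sum of all diagrams with one more box. -/
def U : Module.End ℕ (YoungDiagram →₀ ℕ) :=
  Finsupp.linearCombination ℕ fun mu => ∑ lam ∈ up mu, Finsupp.single lam 1

/-- The operator that maps a diagram to the sum of all diagrams with one box less. -/
def D : Module.End ℕ (YoungDiagram →₀ ℕ) :=
  Finsupp.linearCombination ℕ fun lam => ∑ mu ∈ strips lam 1, Finsupp.single mu 1

lemma U_single (mu : YoungDiagram) :
    U (Finsupp.single mu 1) = ∑ lam ∈ up mu, Finsupp.single lam 1 := by
  rw [U, Finsupp.linearCombination_single, one_smul]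

lemma D_single (lam : YoungDiagram) :
    D (Finsupp.single lam 1) = ∑ mu ∈ strips lam 1, Finsupp.single mu 1 := by
  rw [D, Finsupp.linearCombination_single, one_smul]

lemma D_bot : D (Finsupp.single ⊥ 1) = 0 := by
  rw [D_single]
  refine sum_eq_zero fun mu h => ?_
  have := (mem_strips.1 h).2
  simp [YoungDiagram.card] at this

lemma D_mul_U : D * U = U * D + 1 := by
  refine Finsupp.lhom_ext' fun mu => LinearMap.ext_ring ?_
  change D (U (Finsupp.single mu 1)) = U (D (Finsupp.single mu 1)) + Finsupp.single mu 1
  rw [U_single, D_single, map_sum, map_sum, sum_congr rfl fun lam _ => D_single lam,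
    sum_congr rfl fun lam _ => U_single lam,
    sum_up_sum_strips fun nu => (Finsupp.single nu 1 : YoungDiagram →₀ ℕ), if_pos one_pos,
    Nat.sub_self, strips_zero, sum_singleton]

lemma U_apply (x : YoungDiagram →₀ ℕ) (lam : YoungDiagram) :
    U x lam = ∑ mu ∈ strips lam 1, x mu := by
  classical
  induction x using Finsupp.induction_linear with
  | zero => simp
  | add x y hx hy => simp only [map_add, Finsupp.add_apply, hx, hy, sum_add_distrib]
  | single nu c =>
    rw [U, Finsupp.linearCombination_single, Finsupp.smul_apply, Finsupp.finsetSum_apply]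
    simp only [Finsupp.single_apply, sum_ite_eq, sum_ite_eq', mem_strips_one]
    split_ifs <;> simp

lemma D_apply (x : YoungDiagram →₀ ℕ) (mu : YoungDiagram) :
    D x mu = ∑ lam ∈ up mu, x lam := by
  classical
  induction x using Finsupp.induction_linear with
  | zero => simp
  | add x y hx hy => simp only [map_add, Finsupp.add_apply, hx, hy, sum_add_distrib]
  | single nu c =>
    rw [D, Finsupp.linearCombination_single, Finsupp.smul_apply, Finsupp.finsetSum_apply]
    simp only [Finsupp.single_apply, sum_ite_eq, sum_ite_eq', mem_strips_one]
    split_ifs <;> simp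

lemma notMem_up_self (mu : YoungDiagram) : mu ∉ up mu := fun h => by
  have := (mem_up.1 h).2
  omega

lemma skewSize_eq {lam mu : YoungDiagram} (h : mu ≤ lam) :
    skewSize lam mu = lam.card - mu.card :=
  card_sdiff_of_subset (YoungDiagram.cells_subset_iff.2 h)

lemma le_and_skewSize_eq_one_iff {lam mu : YoungDiagram} :
    mu ≤ lam ∧ skewSize lam mu = 1 ↔ lam ∈ up mu := by
  rw [mem_up]
  refine and_congr_right fun h => ?_
  rw [skewSize_eq h]
  omega

open Classical in
lemma le_and_skewSize_le_one_iff {lam mu : YoungDiagram} :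
    mu ≤ lam ∧ skewSize lam mu ≤ 1 ↔ lam ∈ insert mu (up mu) := by
  rw [mem_insert, ← le_and_skewSize_eq_one_iff]
  constructor
  · rintro ⟨h1, h2⟩
    rcases Nat.le_one_iff_eq_zero_or_eq_one.1 h2 with h | h
    · rw [skewSize, card_eq_zero, sdiff_eq_empty_iff_subset] at h
      exact Or.inl (le_antisymm (YoungDiagram.cells_subset_iff.1 h) h1)
    · exact Or.inr ⟨h1, h⟩
  · rintro (rfl | ⟨h1, h2⟩)
    · simp [skewSize]
    · exact ⟨h1, h2.le⟩

/-- The walks with `2k` steps from the empty diagram to `mu` whose steps satisfy `P` and `Q`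
alternately, starting with `P`. Both kinds of vacillating tableaux are of this form. -/
def walks (P Q : YoungDiagram → YoungDiagram → Prop) (k : ℕ) (mu : YoungDiagram) :
    Set (Fin (2 * k + 1) → YoungDiagram) :=
  {t | t 0 = ⊥ ∧ t (Fin.last (2 * k)) = mu ∧ ∀ (j : ℕ) (_ : j < k),
    P (t ⟨2 * j, by omega⟩) (t ⟨2 * j + 1, by omega⟩) ∧
      Q (t ⟨2 * j + 1, by omega⟩) (t ⟨2 * j + 2, by omega⟩)}

/-- Append to a walk the steps to `rho` and then to `mu`. -/
def appendSteps {k : ℕ} (rho mu : YoungDiagram) (t : Fin (2 * k + 1) → YoungDiagram)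
    (i : Fin (2 * (k + 1) + 1)) : YoungDiagram :=
  if h : (i : ℕ) < 2 * k + 1 then t ⟨i, h⟩ else if (i : ℕ) = 2 * k + 1 then rho else mu

lemma walks_zero (P Q : YoungDiagram → YoungDiagram → Prop) (mu : YoungDiagram) :
    (walks P Q 0 mu).Finite ∧
      (walks P Q 0 mu).ncard = (Finsupp.single ⊥ 1 : YoungDiagram →₀ ℕ) mu := by
  classical
  have hsub : walks P Q 0 mu ⊆ {fun _ => ⊥} := by
    rintro t ⟨h, -⟩
    refine funext fun i => ?_
    rw [← h]
    congr 1
    exact Subsingleton.elim (α := Fin 1) i 0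
  refine ⟨(Set.finite_singleton _).subset hsub, ?_⟩
  rw [Finsupp.single_apply]
  split_ifs with h
  · subst h
    rw [Set.ncard_eq_one]
    refine ⟨fun _ => ⊥, hsub.antisymm ?_⟩
    rintro _ rfl
    exact ⟨rfl, rfl, fun j hj => absurd hj (Nat.not_lt_zero j)⟩
  · rw [Set.ncard_eq_zero ((Set.finite_singleton _).subset hsub),
      Set.eq_empty_iff_forall_notMem]
    rintro t ⟨h1, h2, -⟩
    exact h (h1.symm.trans h2)

lemma walks_succ {P Q : YoungDiagram → YoungDiagram → Prop}
    {p q : YoungDiagram → Finset YoungDiagram}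
    (hp : ∀ lam rho, P lam rho ↔ lam ∈ p rho) (hq : ∀ rho mu, Q rho mu ↔ rho ∈ q mu)
    {k : ℕ} (hfin : ∀ lam, (walks P Q k lam).Finite) (mu : YoungDiagram) :
    (walks P Q (k + 1) mu).Finite ∧ (walks P Q (k + 1) mu).ncard =
      ∑ rho ∈ q mu, ∑ lam ∈ p rho, (walks P Q k lam).ncard := by
  have hlt : ∀ {rho t} (i : ℕ) (hi : i < 2 * k + 1),
      appendSteps (k := k) rho mu t ⟨i, by omega⟩ = t ⟨i, hi⟩ := fun i hi => dif_pos hi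
  have hmid : ∀ {rho t}, appendSteps (k := k) rho mu t ⟨2 * k + 1, by omega⟩ = rho := by
    intro rho t
    simp [appendSteps]
  have hlast : ∀ {rho t}, appendSteps (k := k) rho mu t ⟨2 * k + 2, by omega⟩ = mu := by
    intro rho t
    simp [appendSteps]
  have key := finite_and_ncard_eq_sum (s := walks P Q (k + 1) mu)
    (t := (q mu).sigma p) (X := fun z => walks P Q k z.2) (fun z => hfin z.2)
    (fun z t => appendSteps z.1 mu t) ?_ ?_ ?_
  · rwa [sum_sigma] at key
  · rintro ⟨rho, lam⟩ hz t ⟨h0, h1, h2⟩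
    obtain ⟨hz1, hz2⟩ := mem_sigma.1 hz
    refine ⟨(hlt 0 (by omega)).trans h0, hlast, fun j hj => ?_⟩
    rcases Nat.lt_succ_iff_lt_or_eq.1 hj with hj | rfl
    · rw [hlt (2 * j) (by omega), hlt (2 * j + 1) (by omega), hlt (2 * j + 2) (by omega)]
      exact h2 j hj
    · rw [hlt (2 * j) (by omega), hmid, hlast, hp, hq]
      refine ⟨?_, hz1⟩
      have h1 : t ⟨2 * j, by omega⟩ = lam := h1
      rw [h1]
      exact hz2
  · rintro ⟨rho, lam⟩ - t ⟨-, h1, -⟩ ⟨rho', lam'⟩ - t' ⟨-, h1', -⟩ h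
    have htt : t = t' := funext fun i => by
      have := congrFun h ⟨i, by omega⟩
      simp only at this
      rwa [hlt i i.2, hlt i i.2] at this
    have hrho : rho = rho' := by
      have := congrFun h ⟨2 * k + 1, by omega⟩
      simp only at this
      rwa [hmid, hmid] at this
    subst htt hrho
    have hlam : lam = lam' := h1.symm.trans h1'
    subst hlam
    exact ⟨rfl, rfl⟩
  · rintro t ⟨h0, h1, h2⟩
    refine ⟨⟨t ⟨2 * k + 1, by omega⟩, t ⟨2 * k, by omega⟩⟩, ?_,
      fun i => t ⟨i, by omega⟩, ⟨h0, rfl, fun j hj => h2 j (by omega)⟩, ?_⟩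
    · obtain ⟨h3, h4⟩ := h2 k (Nat.lt_succ_self k)
      refine mem_sigma.2 ⟨?_, (hp _ _).1 h3⟩
      have h1 : t ⟨2 * k + 2, by omega⟩ = mu := h1
      rw [h1] at h4
      exact (hq _ _).1 h4
    · funext ⟨i, hi⟩
      simp only [appendSteps]
      split_ifs with h3 h4
      · rfl
      · subst h4; rfl
      · rw [← h1]
        congr 1
        refine Fin.ext ?_
        simp only [Fin.val_last]
        omega

open Classical in
/-- If the steps `P` remove at most one box, and `X` is the transfer operator of the steps `Q`, then
the numbers of walks are the coefficients of `(X * (1 + D)) ^ k` applied to the empty diagram. -/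
lemma ncard_walks {P Q : YoungDiagram → YoungDiagram → Prop}
    {q : YoungDiagram → Finset YoungDiagram}
    (hp : ∀ lam rho, P lam rho ↔ lam ∈ insert rho (up rho))
    (hq : ∀ rho mu, Q rho mu ↔ rho ∈ q mu) {X : Module.End ℕ (YoungDiagram →₀ ℕ)}
    (hX : ∀ x mu, X x mu = ∑ rho ∈ q mu, x rho) (k : ℕ) (mu : YoungDiagram) :
    (walks P Q k mu).ncard = ((X * (1 + D)) ^ k) (Finsupp.single ⊥ 1) mu := by
  suffices ∀ mu, (walks P Q k mu).Finite ∧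
      (walks P Q k mu).ncard = ((X * (1 + D)) ^ k) (Finsupp.single ⊥ 1) mu from (this mu).2
  induction k with
  | zero => exact walks_zero P Q
  | succ k ih =>
    intro mu
    obtain ⟨h1, h2⟩ := walks_succ hp hq (fun lam => (ih lam).1) mu
    refine ⟨h1, h2.trans ?_⟩
    rw [pow_succ', Module.End.mul_apply, Module.End.mul_apply, hX]
    refine sum_congr rfl fun rho _ => ?_
    rw [sum_insert (notMem_up_self rho), LinearMap.add_apply, Module.End.one_apply,
      Finsupp.add_apply, D_apply, (ih rho).2]
    exact congrArg _ (sum_congr rfl fun lam _ => (ih lam).2)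

lemma a_eq (k : ℕ) (mu : YoungDiagram) :
    a k mu = ((U * (1 + D)) ^ k) (Finsupp.single ⊥ 1) mu := by
  rw [← ncard_walks (P := fun lam rho => rho ≤ lam ∧ skewSize lam rho ≤ 1)
    (Q := fun rho mu => rho ≤ mu ∧ skewSize mu rho = 1) (fun _ _ => le_and_skewSize_le_one_iff)
    (fun _ _ => le_and_skewSize_eq_one_iff.trans mem_strips_one.symm) U_apply]
  rfl

lemma g_eq (k : ℕ) (mu : YoungDiagram) :
    g k mu = (((1 + U) * (1 + D)) ^ k) (Finsupp.single ⊥ 1) mu := by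
  classical
  rw [← ncard_walks (P := fun lam rho => rho ≤ lam ∧ skewSize lam rho ≤ 1)
    (Q := fun rho mu => rho ≤ mu ∧ skewSize mu rho ≤ 1)
    (q := fun mu => insert mu (strips mu 1)) fun _ _ => le_and_skewSize_le_one_iff]
  · rfl
  · intro rho mu
    rw [le_and_skewSize_le_one_iff, mem_insert, mem_insert, mem_strips_one, eq_comm]
  · intro x mu
    rw [sum_insert fun h => notMem_up_self mu (mem_strips_one.1 h), LinearMap.add_apply,
      Module.End.one_apply, Finsupp.add_apply, U_apply]

/-! ### Passing to symmetric functions -/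

/-- The linear map sending a diagram to its Schur function. -/
def toSchur (R : Type*) [CommRing R] : (YoungDiagram →₀ ℕ) →ₗ[ℕ] MvPowerSeries ℕ+ R :=
  Finsupp.linearCombination ℕ (schur R)

lemma finsum_mul_schur (R : Type*) [CommRing R] (x : YoungDiagram →₀ ℕ) :
    ∑ᶠ mu : YoungDiagram, (x mu : MvPowerSeries ℕ+ R) * schur R mu = toSchur R x := by
  rw [toSchur, Finsupp.linearCombination_apply, Finsupp.sum,
    finsum_eq_sum_of_support_subset _ (s := x.support)]
  · simp only [nsmul_eq_mul]
  · intro mu h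
    rw [mem_coe, Finsupp.mem_support_iff]
    intro h0
    exact h (by simp [h0])

/-- The Pieri rule: `toSchur` turns the operator `U` into multiplication by `h_1`. -/
lemma toSchur_U (R : Type*) [CommRing R] (x : YoungDiagram →₀ ℕ) :
    toSchur R (U x) = h1 R * toSchur R x := by
  induction x using Finsupp.induction_linear with
  | zero => simp
  | add x y hx hy => simp only [map_add, hx, hy, mul_add]
  | single mu c =>
    have hs : ∀ mu, toSchur R (Finsupp.single mu 1) = schur R mu := fun mu => by
      rw [toSchur, Finsupp.linearCombination_single, one_smul]
    rw [← mul_one c, ← smul_eq_mul, ← Finsupp.smul_single, map_smul, map_smul, map_smul,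
      U_single, map_sum, hs, sum_congr rfl fun lam _ => hs lam, sum_up_schur, mul_smul_comm]

lemma toSchur_pow {R : Type*} [CommRing R] {X : Module.End ℕ (YoungDiagram →₀ ℕ)}
    {y : MvPowerSeries ℕ+ R} (h : ∀ x, toSchur R (X x) = y * toSchur R x) (n : ℕ) :
    toSchur R ((X ^ n) (Finsupp.single ⊥ 1)) = y ^ n := by
  induction n with
  | zero =>
    rw [pow_zero, pow_zero, Module.End.one_apply, toSchur, Finsupp.linearCombination_single,
      one_smul, schur_bot]
  | succ n ih => rw [pow_succ', Module.End.mul_apply, h, ih, pow_succ']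

/-- Applied to `X = U`, `y = h_1` and to `X = 1 + U`, `y = 1 + h_1`, this evaluates the generating
functions of limiting and of simplified vacillating tableaux. -/
lemma toSchur_pow_eq_sum_finpartition {R : Type*} [CommRing R]
    {X : Module.End ℕ (YoungDiagram →₀ ℕ)} (hDX : D * X = X * D + 1)
    {y : MvPowerSeries ℕ+ R} (h : ∀ x, toSchur R (X x) = y * toSchur R x) (k : ℕ) :
    toSchur R (((X * (1 + D)) ^ k) (Finsupp.single ⊥ 1)) =
      ∑ P : Finpartition (univ : Finset (Fin k)), y ^ P.parts.card := by
  have := pow_apply_eq_sum_finpartition D X hDX D_bot (univ : Finset (Fin k))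
  rw [card_univ, Fintype.card_fin] at this
  rw [this, map_sum]
  exact sum_congr rfl fun P _ => toSchur_pow h _

end VacillatingTableaux

open VacillatingTableaux

theorem mainTheorem5 (R : Type*) [CommRing R] (k : ℕ) :
    ({mu : YoungDiagram | VacillatingTableaux.g k mu ≠ 0}.Finite ∧
      ∑ᶠ mu : YoungDiagram,
          (VacillatingTableaux.g k mu : MvPowerSeries ℕ+ R) * VacillatingTableaux.schur R mu =
        ∑ j ∈ Finset.range (k + 1),
          (VacillatingTableaux.B k j : MvPowerSeries ℕ+ R) * VacillatingTableaux.h1 R ^ j) ∧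
    ({mu : YoungDiagram | VacillatingTableaux.a k mu ≠ 0}.Finite ∧
      {j : ℕ | VacillatingTableaux.S k j ≠ 0}.Finite ∧
      ∑ᶠ mu : YoungDiagram,
          (VacillatingTableaux.a k mu : MvPowerSeries ℕ+ R) * VacillatingTableaux.schur R mu =
        ∑ᶠ j : ℕ,
          (VacillatingTableaux.S k j : MvPowerSeries ℕ+ R) * VacillatingTableaux.h1 R ^ j) := by
  have hfin : ∀ x : YoungDiagram →₀ ℕ, {mu | x mu ≠ 0}.Finite := fun x => x.hasFiniteSupport
  have hS : ∀ j, S k j ≠ 0 → j ∈ range (k + 1) := fun j hj =>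
    mem_range.2 (Nat.lt_succ_of_le (not_lt.1 fun h => hj (S_eq_zero h)))
  simp only [g_eq, a_eq]
  refine ⟨⟨hfin _, ?_⟩, hfin _, (range (k + 1)).finite_toSet.subset hS, ?_⟩
  · have hcomm : D * (1 + U) = (1 + U) * D + 1 := by
      rw [mul_add, add_mul, D_mul_U, mul_one, one_mul, add_assoc]
    have h : ∀ x, toSchur R ((1 + U) x) = (1 + h1 R) * toSchur R x := fun x => by
      rw [LinearMap.add_apply, Module.End.one_apply, map_add, toSchur_U, add_mul, one_mul]
    rw [finsum_mul_schur, toSchur_pow_eq_sum_finpartition hcomm h, sum_B]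
  · rw [finsum_mul_schur, toSchur_pow_eq_sum_finpartition D_mul_U (toSchur_U R),
      sum_S fun n => h1 R ^ n, finsum_eq_sum_of_support_subset _ (s := range (k + 1))]
    · simp only [nsmul_eq_mul]
    · intro j hj
      refine mem_coe.2 (hS j fun h0 => hj ?_)
      simp [h0]

end
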